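/- Fix monadic predicate symbols $\mathsf{pr}_1,\dots,\mathsf{pr}_\ell$. Formulas of $\mathsf{WS1S}$ are built from atoms $t_1=t_2$, $\mathsf{pr}_k(t)$ and $X(t)$ (where $X$ is a set variable and $t$ is a term built from the constant $\bar 0$, first-order variables and the successor function $s$) by conjunction, negation, and the quantifiers $\exists x$ and $\exists X$. The formula $t_1\le t_2$ abbreviates: every set that contains $t_1$ and is closed under $s$ contains $t_2$. A sentence is a formula without free variables. Sentences are interpreted in structures $\mathcal S=([n],\iota)$ with $n\ge 1$, $[n]=\{0,\dots,n-1\}$ and $\iota(\mathsf{pr}_k)\subseteq[n]$; here $s(x)=x+1$ for $x<n-1$ and $s(n-1)=n-1$. The word of $\mathcal S$ is $w_{\mathcal S}=\sigma_0\cdots\sigma_{n-1}$ over $\{0,1\}^\ell$ with $\sigma_i(k)=1$ iff $i\in\iota(\mathsf{pr}_k)$. Write $([n],\iota)\sqsubseteq([n],\iota')$ if $\iota(\mathsf{pr}_k)\subseteq\iota'(\mathsf{pr}_k)$ for all $k$. A minimal model of a sentence is a model $\mathcal S$ such that no $\mathcal S'\sqsubseteq\mathcal S$ with $\mathcal S'\ne\mathcal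 S$ is a model. A formula is positive if every predicate symbol $\mathsf{pr}_k$ occurs in it only under an even number of negations (disjunction, implication and universal quantification being abbreviations). Let $\varphi$ be a $\mathsf{WS1S}$ sentence over $\mathsf{pr}_1,\dots,\mathsf{pr}_\ell$. An automaton for $\varphi$ is a nondeterministic finite automaton $A_\varphi=(Q,I,F,\delta)$ over the alphabet $\{0,1\}^\ell$, with $Q=\{s_1,\dots,s_q\}$, such that $\mathcal S\models\varphi\iff w_{\mathcal S}\in L(A_\varphi)$ for every structure $\mathcal S$. The saturated automaton is $A^*_\varphi=(Q,I,F,\delta^*)$ with $\delta^*=\{(s,\tau,s') : (s,\sigma,s')\in\delta \text{ for some } \sigma\le\tau\}$, where letters are ordered componentwise. Let $$\mathrm{ppos}(\varphi)=\exists X_1\cdots\exists X_q.\ \psi_{cover}\wedge\psi_I\wedge\psi^*_\delta\wedge\psi^*_F,$$ where $$\psi_{cover}=\forall x.\ \bigvee_{i}X_i(x)\wedge\bigwedge_{i<j}(\neg X_i(x)\vee\neg X_j(x)),\qquad \psi_I=\bigvee_{s_i\in I}X_i(\bar 0),$$ $$\psi^*_\delta=\forall x\,\forall y.\ y\le x\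 \vee\bigvee_{(s_i,\sigma,s_j)\in\delta}\Big(X_i(x)\wedge X_j(s(x))\wedge\bigwedge_{\sigma(k)=1}\mathsf{pr}_k(x)\Big),$$ $$\psi^*_F=\exists x.\ (\forall y.\ y\le x)\ \wedge\bigvee_{(s_i,\sigma,s_j)\in\delta,\ s_j\in F}\Big(X_i(x)\wedge\bigwedge_{\sigma(k)=1}\mathsf{pr}_k(x)\Big).$$ Then an automaton for $\varphi$ exists and, for every automaton $A_\varphi$ for $\varphi$, the sentence $\mathrm{ppos}(\varphi)$ is positive and 1. for every structure $\mathcal S$: $\mathcal S\models\mathrm{ppos}(\varphi)$ if and only if $w_{\mathcal S}\in L(A^*_\varphi)$; 2. $\varphi$ and $\mathrm{ppos}(\varphi)$ have the same minimal models. -/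

import Mathlib

namespace WS1S

/-! ### Syntax

Formulas over the monadic predicate symbols `pr_1, …, pr_ℓ` (indexed by `Fin ℓ`), with `k` free
first-order variables and `m` free set variables. A quantifier binds the variable of index `0`
and shifts the indices of the other ones by one. -/

/-- Terms: the constant zero, first-order variables, successor. -/
inductive Term (k : ℕ) : Type
  | zero : Term k
  | var (i : Fin k) : Term k
  | succ (t : Term k) : Term k

/-- Formulas: `t₁ = t₂`, `pr_j(t)`, `X_i(t)`, conjunction, negation, `∃ x` and `∃ X`. -/
inductive Formula (ℓ : ℕ) : ℕ → ℕ → Type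
  | eq {k m : ℕ} (t₁ t₂ : Term k) : Formula ℓ k m
  | pr {k m : ℕ} (j : Fin ℓ) (t : Term k) : Formula ℓ k m
  | mem {k m : ℕ} (i : Fin m) (t : Term k) : Formula ℓ k m
  | and {k m : ℕ} (φ ψ : Formula ℓ k m) : Formula ℓ k m
  | neg {k m : ℕ} (φ : Formula ℓ k m) : Formula ℓ k m
  | ex {k m : ℕ} (φ : Formula ℓ (k + 1) m) : Formula ℓ k m
  | exSet {k m : ℕ} (φ : Formula ℓ k (m + 1)) : Formula ℓ k m

/-- Sentences: formulas without free variables. -/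
abbrev Sentence (ℓ : ℕ) : Type := Formula ℓ 0 0

namespace Formula

variable {ℓ k m : ℕ}

/-! ### Derived connectives -/

def or (φ ψ : Formula ℓ k m) : Formula ℓ k m := neg (and (neg φ) (neg ψ))

def imp (φ ψ : Formula ℓ k m) : Formula ℓ k m := or (neg φ) ψ

def all (φ : Formula ℓ (k + 1) m) : Formula ℓ k m := neg (ex (neg φ))

def allSet (φ : Formula ℓ k (m + 1)) : Formula ℓ k m := neg (exSet (neg φ))

def top : Formula ℓ k m := eq Term.zero Term.zero

def bot : Formula ℓ k m := neg top

/-- `t₁ ≤ t₂`: every set that contains `t₁` and is closed under successor contains `t₂`. -/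
def le (t₁ t₂ : Term k) : Formula ℓ k m :=
  allSet (imp (and (mem 0 t₁) (all (imp (mem 0 (Term.var 0)) (mem 0 (Term.succ (Term.var 0))))))
    (mem 0 t₂))

/-- Finite disjunction; the empty one is false. -/
noncomputable def bigOr {α : Type} (s : Finset α) (f : α → Formula ℓ k m) : Formula ℓ k m :=
  (s.toList.map f).foldr or bot

/-- Finite conjunction; the empty one is true. -/
noncomputable def bigAnd {α : Type} (s : Finset α) (f : α → Formula ℓ k m) : Formula ℓ k m :=
  (s.toList.map f).foldr and top

/-- `∃ X_1 … ∃ X_m . φ`. -/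
def exSets : {m : ℕ} → Formula ℓ k m → Formula ℓ k 0
  | 0, φ => φ
  | _ + 1, φ => exSets (exSet φ)

/-! ### Positive formulas -/

/-- `OccursWithParity b φ`: every occurrence of a predicate symbol `pr_j` in `φ` is under an even
(if `b = true`), respectively odd (if `b = false`), number of negations. -/
def OccursWithParity : Bool → {k m : ℕ} → Formula ℓ k m → Prop
  | _, _, _, eq _ _ => True
  | b, _, _, pr _ _ => b = true
  | _, _, _, mem _ _ => True
  | b, _, _, and φ ψ => OccursWithParity b φ ∧ OccursWithParity b ψ
  | b, _, _, neg φ => OccursWithParity (!b) φ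
  | b, _, _, ex φ => OccursWithParity b φ
  | b, _, _, exSet φ => OccursWithParity b φ

/-- Every predicate symbol occurs under an even number of negations. -/
def Positive (φ : Formula ℓ k m) : Prop := OccursWithParity true φ

end Formula

/-! ### Semantics over the universe `[n] = {0, …, n - 1}`, `n > 0` -/

/-- The successor on `[n]`, which loops on the greatest element `n - 1`. -/
def next {n : ℕ} (i : Fin n) : Fin n := if h : i.val + 1 < n then ⟨i.val + 1, h⟩ else i

def Term.eval {n k : ℕ} [NeZero n] (ν : Fin k → Fin n) : Term k → Fin n
  | .zero => 0
  | .var i => ν i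
  | .succ t => next (t.eval ν)

/-- `([n], ν, ι, μ) ⊨ φ`. -/
def Formula.Sat {ℓ n : ℕ} [NeZero n] (ι : Fin ℓ → Finset (Fin n)) :
    {k m : ℕ} → Formula ℓ k m → (Fin k → Fin n) → (Fin m → Finset (Fin n)) → Prop
  | _, _, .eq t₁ t₂, ν, _ => t₁.eval ν = t₂.eval ν
  | _, _, .pr j t, ν, _ => t.eval ν ∈ ι j
  | _, _, .mem i t, ν, μ => t.eval ν ∈ μ i
  | _, _, .and φ ψ, ν, μ => φ.Sat ι ν μ ∧ ψ.Sat ι ν μ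
  | _, _, .neg φ, ν, μ => ¬ φ.Sat ι ν μ
  | _, _, .ex φ, ν, μ => ∃ a : Fin n, φ.Sat ι (Fin.cons (α := fun _ => Fin n) a ν) μ
  | _, _, .exSet φ, ν, μ =>
      ∃ B : Finset (Fin n), φ.Sat ι ν (Fin.cons (α := fun _ => Finset (Fin n)) B μ)

/-- Structures `([n], ι)`, `n > 0`, for sentences over `pr_1, …, pr_ℓ`: the interpretations of
first-order and set variables have empty domain. -/
structure Structure (ℓ : ℕ) : Type where
  n : ℕ
  [pos : NeZero n]
  ι : Fin ℓ → Finset (Fin n)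

attribute [instance] Structure.pos

/-- `S ⊨ φ` for a sentence `φ`. -/
def Structure.Models {ℓ : ℕ} (S : Structure ℓ) (φ : Sentence ℓ) : Prop :=
  φ.Sat S.ι Fin.elim0 Fin.elim0

/-- `S₁ ⊑ S₂`: the same universe, and pointwise inclusion of the predicates. -/
def Structure.Sub {ℓ : ℕ} (S₁ S₂ : Structure ℓ) : Prop :=
  ∃ h : S₁.n = S₂.n, ∀ (j : Fin ℓ) (i : Fin S₁.n), i ∈ S₁.ι j → Fin.cast h i ∈ S₂.ι j

/-- The set of minimal models of a sentence. -/
def minModels {ℓ : ℕ} (φ : Sentence ℓ) : Set (Structure ℓ) :=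
  {S | S.Models φ ∧ ∀ S' : Structure ℓ, S'.Sub S → S' ≠ S → ¬ S'.Models φ}

/-- Minimal equivalence: the same minimal models. -/
def MinEquiv {ℓ : ℕ} (φ ψ : Sentence ℓ) : Prop := minModels φ = minModels ψ

/-! ### Words and automata -/

/-- The alphabet `{0,1}^ℓ`, with its pointwise order. -/
abbrev Letter (ℓ : ℕ) : Type := Fin ℓ → Bool

/-- The word `σ_0 … σ_{n-1}` of a structure: `σ_i(j) = 1` if and only if `i ∈ ι(pr_j)`. -/
def Structure.word {ℓ : ℕ} (S : Structure ℓ) : List (Letter ℓ) :=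
  List.ofFn fun (i : Fin S.n) (j : Fin ℓ) => decide (i ∈ S.ι j)

/-- `A` is an automaton for the sentence `φ`: it accepts exactly the words of the models of `φ`,
among the words of structures. -/
def IsAutomatonFor {ℓ q : ℕ} (A : NFA (Letter ℓ) (Fin q)) (φ : Sentence ℓ) : Prop :=
  ∀ S : Structure ℓ, S.Models φ ↔ S.word ∈ A.accepts

/-- The saturated automaton: `(s, τ, s')` is a transition of it if and only if `(s, σ, s')` is a
transition of `A` for some letter `σ ≤ τ`. -/
def saturate {ℓ q : ℕ} (A : NFA (Letter ℓ) (Fin q)) : NFA (Letter ℓ) (Fin q) where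
  step s τ := {s' | ∃ σ : Letter ℓ, σ ≤ τ ∧ s' ∈ A.step s σ}
  start := A.start
  accept := A.accept

/-! ### Positivation -/

section Positivation

open Classical Formula

variable {ℓ q : ℕ} (A : NFA (Letter ℓ) (Fin q))

/-- The finite set of transitions `(s_i, σ, s_j)`. -/
noncomputable def transitions : Finset (Fin q × Letter ℓ × Fin q) :=
  Finset.univ.filter fun d => d.2.2 ∈ A.step d.1 d.2.1

/-- The conjunction of the atoms `pr_k(t)` over all `k` with `σ(k) = 1`. -/
noncomputable def ones {k m : ℕ} (σ : Letter ℓ) (t : Term k) : Formula ℓ k m :=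
  bigAnd (Finset.univ.filter fun j => σ j = true) fun j => pr j t

/-- Each position `x` is in exactly one of the sets `X_1, …, X_q`. -/
noncomputable def psiCover (ℓ q : ℕ) : Formula ℓ 0 q :=
  all (and (bigOr Finset.univ fun i => mem i (Term.var 0))
    (bigAnd (Finset.univ.filter fun p : Fin q × Fin q => p.1 < p.2) fun p =>
      or (neg (mem p.1 (Term.var 0))) (neg (mem p.2 (Term.var 0)))))

/-- Position `0` is labelled with an initial state. -/
noncomputable def psiInit : Formula ℓ 0 q :=
  bigOr (Finset.univ.filter fun i => i ∈ A.start) fun i => mem i Term.zero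

/-- `∀ x ∀ y . y ≤ x ∨ ⋁ X_i(x) ∧ X_j(succ(x)) ∧ ⋀ pr_k(x)`, where the disjunction is over the
transitions `(s_i, σ, s_j)` and the conjunction over `σ(k) = 1`; here `x` has index `1` and `y`
has index `0`. -/
noncomputable def psiStep : Formula ℓ 0 q :=
  all (all (or (le (Term.var 0) (Term.var 1))
    (bigOr (transitions A) fun d =>
      and (mem d.1 (Term.var 1)) (and (mem d.2.2 (Term.succ (Term.var 1)))
        (ones d.2.1 (Term.var 1))))))

/-- `∃ x . (∀ y . y ≤ x) ∧ ⋁ X_i(x) ∧ ⋀ pr_k(x)`, where the disjunction is over the transitions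
`(s_i, σ, s_j)` with final target `s_j`: the last letter leads into a final state. -/
noncomputable def psiFinal : Formula ℓ 0 q :=
  ex (and (all (le (Term.var 0) (Term.var 1)))
    (bigOr ((transitions A).filter fun d => d.2.2 ∈ A.accept) fun d =>
      and (mem d.1 (Term.var 0)) (ones d.2.1 (Term.var 0))))

/-- The positive sentence `ppos(φ)` obtained from an automaton `A` for `φ`. -/
noncomputable def ppos : Sentence ℓ :=
  exSets (and (psiCover ℓ q) (and (psiInit A) (and (psiStep A) (psiFinal A))))

end Positivation

end WS1S

/-! An automaton for `φ` exists by Büchi's argument. An interpretation is coded as a word with one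
track per predicate symbol and per free variable, and induction on the formula (`Recognizable.sat`)
turns negation into complement, conjunction into intersection and quantifiers into projection of a
track.

In `ppos A`, the cover condition makes the sets `X_i` a labelling of positions by states, and the
remaining conjuncts say that it is an accepting run. Since only the bits with `σ(k) = 1` are tested,
each transition is followed up to enlarging its letter, which is a step of the saturated automaton
(`models_ppos_iff`).

A word is accepted by the saturated automaton iff lowering some of its bits gives a word accepted by
`A` (`word_mem_saturate_iff`). So the models of `ppos A` are the upward closure of those of `φ`, and
a set and its upward closure have the same minimal elements in any partial order
(`minEquiv_of_models_iff`). -/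

/-! ### Runs of automata and closure properties of regular languages. -/

/-- Runs are total functions on `ℕ`, of which only the values at `0, …, n` matter; this avoids casts
between `Fin n` and `Fin (n + 1)`. -/
theorem NFA.ofFn_mem_acceptsFrom_iff {α σ : Type} (M : NFA α σ) {n : ℕ} (f : Fin n → α)
    (S : Set σ) :
    List.ofFn f ∈ M.acceptsFrom S ↔ ∃ r : ℕ → σ, r 0 ∈ S ∧ r n ∈ M.accept ∧
      ∀ i : Fin n, r (i + 1) ∈ M.step (r i) (f i) := by
  induction n generalizing S with
  | zero =>
    simp only [List.ofFn_zero, NFA.nil_mem_acceptsFrom]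
    constructor
    · rintro ⟨s, hs, ha⟩
      exact ⟨fun _ => s, hs, ha, fun i => i.elim0⟩
    · rintro ⟨r, hs, ha, -⟩
      exact ⟨r 0, hs, ha⟩
  | succ n ih =>
    rw [List.ofFn_succ, NFA.cons_mem_acceptsFrom, ih]
    constructor
    · rintro ⟨r, h0, hn, hr⟩
      obtain ⟨t, ht, hs⟩ := NFA.mem_stepSet.1 h0
      refine ⟨fun i => Nat.casesOn i t r, ht, hn, fun i => ?_⟩
      refine Fin.cases hs (fun j => ?_) i
      exact hr j
    · rintro ⟨r, h0, hn, hr⟩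
      refine ⟨fun i => r (i + 1), NFA.mem_stepSet.2 ⟨r 0, h0, hr 0⟩, hn, fun i => ?_⟩
      exact hr i.succ

theorem NFA.ofFn_mem_accepts_iff {α σ : Type} (M : NFA α σ) {n : ℕ} (f : Fin n → α) :
    List.ofFn f ∈ M.accepts ↔ ∃ r : ℕ → σ, r 0 ∈ M.start ∧ r n ∈ M.accept ∧
      ∀ i : Fin n, r (i + 1) ∈ M.step (r i) (f i) :=
  M.ofFn_mem_acceptsFrom_iff f M.start

theorem NFA.isRegular_accepts {α σ : Type} [Finite σ] (M : NFA α σ) : M.accepts.IsRegular := by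
  classical
  have := Fintype.ofFinite σ
  exact ⟨Set σ, inferInstance, M.toDFA, M.toDFA_correct⟩

theorem Language.IsRegular.exists_nfa {α : Type} {L : Language α} (h : L.IsRegular) :
    ∃ (q : ℕ) (A : NFA α (Fin q)), A.accepts = L := by
  obtain ⟨σ, _, M, rfl⟩ := h
  exact ⟨_, (DFA.reindex (Fintype.equivFin σ) M).toNFA, by simp⟩

/-- The image of a regular language under a letter-to-letter map is regular. -/
theorem Language.IsRegular.exists_image {α β : Type} {L : Language α} (h : L.IsRegular)
    (g : α → β) :
    ∃ L' : Language β, L'.IsRegular ∧ ∀ (n : ℕ) (f : Fin n → β),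
      List.ofFn f ∈ L' ↔ ∃ f' : Fin n → α, (∀ i, g (f' i) = f i) ∧ List.ofFn f' ∈ L := by
  obtain ⟨q, M, rfl⟩ := h.exists_nfa
  refine ⟨_, NFA.isRegular_accepts (σ := Fin q)
    ⟨fun s b => {s' | ∃ a, g a = b ∧ s' ∈ M.step s a}, M.start, M.accept⟩, fun n f => ?_⟩
  simp only [NFA.ofFn_mem_accepts_iff]
  constructor
  · rintro ⟨r, h0, hn, hr⟩
    choose f' hg hs using hr
    exact ⟨f', hg, r, h0, hn, hs⟩
  · rintro ⟨f', hg, r, h0, hn, hr⟩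
    exact ⟨r, h0, hn, fun i => ⟨f' i, hg i, hr i⟩⟩

/-- Languages given by conditions on the first letter, the adjacent letters and the last letter
are regular. -/
theorem Language.exists_isRegular_local {α : Type} [Finite α] (p q : α → Prop)
    (R : α → α → Prop) :
    ∃ L : Language α, L.IsRegular ∧ ∀ (n : ℕ) (f : Fin n → α), List.ofFn f ∈ L ↔
      (∀ i : Fin n, i.val = 0 → p (f i)) ∧
      (∀ i j : Fin n, j.val = i.val + 1 → R (f i) (f j)) ∧
      (∀ i : Fin n, i.val + 1 = n → q (f i)) := by
  -- The state is the last letter read, `none` before the first one.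
  refine ⟨_, NFA.isRegular_accepts (σ := Option α)
    ⟨fun s a => {s' | s' = some a ∧ s.elim (p a) (fun b => R b a)}, {none},
      {s | s.elim True q}⟩, fun n f => ?_⟩
  rw [NFA.ofFn_mem_accepts_iff]
  constructor
  · rintro ⟨r, h0, hn, hr⟩
    have h0 : r 0 = none := h0
    have hn : (r n).elim True q := hn
    have hr (i : Fin n) : r (i + 1) = some (f i) ∧ (r i).elim (p (f i)) (fun b => R b (f i)) :=
      hr i
    refine ⟨fun i hi => ?_, fun i j hij => ?_, fun i hi => ?_⟩
    · simpa [hi, h0] using (hr i).2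
    · have := (hr j).2
      rw [hij, (hr i).1] at this
      exact this
    · rw [← hi, (hr i).1] at hn
      exact hn
  · rintro ⟨hp, hR, hq⟩
    let r : ℕ → Option α := fun i =>
      Nat.casesOn i none fun k => if h : k < n then some (f ⟨k, h⟩) else none
    have hr (i : Fin n) : r (i + 1) = some (f i) := by simp [r]
    refine ⟨r, rfl, ?_, fun i => ⟨hr i, ?_⟩⟩
    · change (r n).elim True q
      obtain _ | k := n
      · trivial
      · have h := hr (Fin.last k)
        rw [Fin.val_last] at h
        rw [h]
        exact hq _ rfl
    · obtain ⟨_ | k, hi⟩ := i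
      · exact hp _ rfl
      · have h := hr ⟨k, by omega⟩
        simp only at h ⊢
        rw [h]
        exact hR _ _ rfl

/-- The words with exactly one letter that satisfies `p` form a regular language. -/
theorem Language.exists_isRegular_existsUnique {α : Type} (p : α → Prop) :
    ∃ L : Language α, L.IsRegular ∧ ∀ (n : ℕ) (f : Fin n → α), List.ofFn f ∈ L ↔
      ∃ a : Fin n, ∀ i, p (f i) ↔ a = i := by
  -- The state records whether a letter satisfying `p` has occurred; a second one has no transition.
  refine ⟨_, NFA.isRegular_accepts (σ := Bool)
    ⟨fun s a => {s' | (p a ∧ s = false ∧ s' = true) ∨ (¬ p a ∧ s' = s)}, {false},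
      {true}⟩, fun n f => ?_⟩
  rw [NFA.ofFn_mem_accepts_iff]
  constructor
  · rintro ⟨r, h0, hn, hr⟩
    have h0 : r 0 = false := h0
    have hn : r n = true := hn
    have hr (i : Fin n) : (p (f i) ∧ r i = false ∧ r (i + 1) = true) ∨
      (¬ p (f i) ∧ r (i + 1) = r i) := hr i
    have key (k : ℕ) (hk : k ≤ n) : (r k = false ∧ ∀ i : Fin n, i.val < k → ¬ p (f i)) ∨
        (r k = true ∧ ∃ a : Fin n, a.val < k ∧ ∀ i : Fin n, i.val < k → (p (f i) ↔ a = i)) := by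
      induction k with
      | zero => exact .inl ⟨h0, fun i hi => by omega⟩
      | succ k ih =>
        have e (i : Fin n) (hi : i.val < k + 1) : i.val < k ∨ i = ⟨k, hk⟩ := by
          rw [Fin.ext_iff]; simp only; omega
        rcases ih (by omega) with ⟨h1, h2⟩ | ⟨h1, a, ha, h2⟩ <;>
          rcases hr ⟨k, hk⟩ with ⟨h3, h4, h5⟩ | ⟨h3, h4⟩
        · refine .inr ⟨h5, ⟨k, hk⟩, Nat.lt_succ_self k, fun i hi => ?_⟩
          rcases e i hi with h | rfl
          · simp only [h2 i h, false_iff]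
            rintro rfl
            exact lt_irrefl _ h
          · simp [h3]
        · refine .inl ⟨h4.trans h1, fun i hi => ?_⟩
          rcases e i hi with h | rfl
          · exact h2 i h
          · exact h3
        · simp [h1] at h4
        · refine .inr ⟨h4.trans h1, a, by omega, fun i hi => ?_⟩
          rcases e i hi with h | rfl
          · exact h2 i h
          · simp only [h3, false_iff]
            rintro rfl
            exact lt_irrefl _ ha
    rcases key n le_rfl with ⟨h1, -⟩ | ⟨-, a, -, h⟩
    · simp [h1] at hn
    · exact ⟨a, fun i => h i i.isLt⟩
  · rintro ⟨a, ha⟩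
    refine ⟨fun i => decide (a.val < i), by simp, by simp, fun i => ?_⟩
    by_cases h : a = i
    · exact .inl ⟨(ha i).2 h, by simp [h], by simp [h]⟩
    · refine .inr ⟨fun hp => h ((ha i).1 hp), ?_⟩
      rw [Fin.ext_iff] at h
      simp only [decide_eq_decide]
      omega

/-! ### Büchi's theorem: satisfaction is recognizable. -/

namespace WS1S

/-- Letters for interpretations of predicate symbols, first-order variables and set variables. -/
abbrev TrackLetter (ℓ k m : ℕ) : Type := (Fin ℓ → Bool) × (Fin k → Bool) × (Fin m → Bool)

/-- The `i`-th letter of the word that encodes an interpretation. -/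
def trackWord {ℓ k m n : ℕ} (ι : Fin ℓ → Finset (Fin n)) (ν : Fin k → Fin n)
    (μ : Fin m → Finset (Fin n)) (i : Fin n) : TrackLetter ℓ k m :=
  (fun j => decide (i ∈ ι j), fun x => decide (ν x = i), fun X => decide (i ∈ μ X))

/-- Properties of interpretations. -/
abbrev Property (ℓ k m : ℕ) : Type :=
  ∀ (n : ℕ) [NeZero n], (Fin ℓ → Finset (Fin n)) → (Fin k → Fin n) →
    (Fin m → Finset (Fin n)) → Prop

/-- A property of interpretations is recognizable if a regular language decides it. -/
def Recognizable {ℓ k m : ℕ} (P : Property ℓ k m) : Prop :=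
  ∃ L : Language (TrackLetter ℓ k m), L.IsRegular ∧ ∀ (n : ℕ) [NeZero n]
    (ι : Fin ℓ → Finset (Fin n)) (ν : Fin k → Fin n) (μ : Fin m → Finset (Fin n)),
    P n ι ν μ ↔ List.ofFn (trackWord ι ν μ) ∈ L

namespace Recognizable

variable {ℓ k m : ℕ}

theorem not {P : Property ℓ k m} (h : Recognizable P) :
    Recognizable fun n _ ι ν μ => ¬ P n ι ν μ := by
  obtain ⟨L, hL, h⟩ := h
  exact ⟨Lᶜ, hL.compl, fun n _ ι ν μ => not_congr (h n ι ν μ)⟩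

theorem and {P Q : Property ℓ k m} (hP : Recognizable P) (hQ : Recognizable Q) :
    Recognizable fun n _ ι ν μ => P n ι ν μ ∧ Q n ι ν μ := by
  obtain ⟨L, hL, hP⟩ := hP
  obtain ⟨L', hL', hQ⟩ := hQ
  exact ⟨L ⊓ L', hL.inf hL', fun n _ ι ν μ => and_congr (hP n ι ν μ) (hQ n ι ν μ)⟩

/-- `L` is controlled only on words that encode interpretations, so before projecting it is
intersected with the words whose new track marks exactly one position. Set tracks need no such
restriction. -/
theorem exists_fst {P : Property ℓ (k + 1) m} (h : Recognizable P) :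
    Recognizable fun n _ ι ν μ => ∃ a : Fin n, P n ι (Fin.cons (α := fun _ => Fin n) a ν) μ := by
  obtain ⟨L, hL, h⟩ := h
  obtain ⟨E, hE, hE'⟩ := Language.exists_isRegular_existsUnique
    (fun a : TrackLetter ℓ (k + 1) m => a.2.1 0 = true)
  obtain ⟨L', hL', h'⟩ := (hL.inf hE).exists_image
    (fun a : TrackLetter ℓ (k + 1) m => ((a.1, Fin.tail a.2.1, a.2.2) : TrackLetter ℓ k m))
  refine ⟨L', hL', fun n _ ι ν μ => ?_⟩
  rw [h']
  constructor
  · rintro ⟨a, ha⟩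
    refine ⟨trackWord ι (Fin.cons (α := fun _ => Fin n) a ν) μ, fun i => rfl,
      (h n ι _ μ).1 ha, (hE' n _).2 ⟨a, fun i => by simp [trackWord]⟩⟩
  · rintro ⟨f, hf, hfL, hfE⟩
    obtain ⟨a, ha⟩ := (hE' n f).1 hfE
    refine ⟨a, (h n ι _ μ).2 ?_⟩
    suffices trackWord ι (Fin.cons (α := fun _ => Fin n) a ν) μ = f by rwa [this]
    funext i
    have h1 := congrArg (fun z => z.1) (hf i)
    have h2 := congrArg (fun z => z.2.1) (hf i)
    have h3 := congrArg (fun z => z.2.2) (hf i)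
    refine Prod.ext h1.symm (Prod.ext ?_ h3.symm)
    funext x
    refine Fin.cases ?_ (fun y => (congrFun h2 y).symm) x
    rw [Bool.eq_iff_iff, ha i]
    simp [trackWord]

theorem exists_set {P : Property ℓ k (m + 1)} (h : Recognizable P) :
    Recognizable fun n _ ι ν μ =>
      ∃ B : Finset (Fin n), P n ι ν (Fin.cons (α := fun _ => Finset (Fin n)) B μ) := by
  obtain ⟨L, hL, h⟩ := h
  obtain ⟨L', hL', h'⟩ := hL.exists_image
    (fun a : TrackLetter ℓ k (m + 1) => ((a.1, a.2.1, Fin.tail a.2.2) : TrackLetter ℓ k m))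
  refine ⟨L', hL', fun n _ ι ν μ => ?_⟩
  rw [h']
  constructor
  · rintro ⟨B, hB⟩
    exact ⟨trackWord ι ν (Fin.cons (α := fun _ => Finset (Fin n)) B μ), fun i => rfl,
      (h n ι ν _).1 hB⟩
  · rintro ⟨f, hf, hfL⟩
    refine ⟨Finset.univ.filter fun i => (f i).2.2 0 = true, (h n ι ν _).2 ?_⟩
    suffices trackWord ι ν (Fin.cons (α := fun _ => Finset (Fin n))
      (Finset.univ.filter fun i => (f i).2.2 0 = true) μ) = f by rwa [this]
    funext i
    have h1 := congrArg (fun z => z.1) (hf i)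
    have h2 := congrArg (fun z => z.2.1) (hf i)
    have h3 := congrArg (fun z => z.2.2) (hf i)
    refine Prod.ext h1.symm (Prod.ext h2.symm ?_)
    funext x
    refine Fin.cases ?_ (fun y => (congrFun h3 y).symm) x
    simp [trackWord]

/-- Properties that only depend on the first letter, the adjacent letters and the last letter. -/
theorem of_local {P : Property ℓ k m} (p q : TrackLetter ℓ k m → Prop)
    (R : TrackLetter ℓ k m → TrackLetter ℓ k m → Prop)
    (h : ∀ (n : ℕ) [NeZero n] (ι : Fin ℓ → Finset (Fin n)) (ν : Fin k → Fin n)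
      (μ : Fin m → Finset (Fin n)), P n ι ν μ ↔
        (∀ i : Fin n, i.val = 0 → p (trackWord ι ν μ i)) ∧
        (∀ i j : Fin n, j.val = i.val + 1 → R (trackWord ι ν μ i) (trackWord ι ν μ j)) ∧
        (∀ i : Fin n, i.val + 1 = n → q (trackWord ι ν μ i))) :
    Recognizable P := by
  obtain ⟨L, hL, hL'⟩ := Language.exists_isRegular_local p q R
  exact ⟨L, hL, fun n _ ι ν μ => (h n ι ν μ).trans (hL' n _).symm⟩

/-- Properties that say that each letter satisfies `p`. -/
theorem of_forall {P : Property ℓ k m} (p : TrackLetter ℓ k m → Prop)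
    (h : ∀ (n : ℕ) [NeZero n] (ι : Fin ℓ → Finset (Fin n)) (ν : Fin k → Fin n)
      (μ : Fin m → Finset (Fin n)), P n ι ν μ ↔ ∀ i : Fin n, p (trackWord ι ν μ i)) :
    Recognizable P := by
  -- Every letter is either the first one or the right member of an adjacent pair.
  refine of_local p (fun _ => True) (fun _ => p) fun n _ ι ν μ => ?_
  rw [h]
  refine ⟨fun H => ⟨fun i _ => H i, fun _ j _ => H j, fun _ _ => trivial⟩, fun H i => ?_⟩
  obtain ⟨_ | i, hi⟩ := i
  · exact H.1 _ rfl
  · exact H.2.1 ⟨i, by omega⟩ _ rfl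

theorem var_eq (x y : Fin k) :
    Recognizable (ℓ := ℓ) (k := k) (m := m) fun _ _ _ ν _ => ν x = ν y := by
  refine of_forall (fun a => a.2.1 x = true → a.2.1 y = true) fun n _ ι ν μ => ?_
  simp only [trackWord, decide_eq_true_eq]
  exact ⟨fun h i hi => h ▸ hi, fun h => (h _ rfl).symm⟩

theorem var_mem_pred (j : Fin ℓ) (x : Fin k) :
    Recognizable (ℓ := ℓ) (k := k) (m := m) fun _ _ ι ν _ => ν x ∈ ι j := by
  refine of_forall (fun a => a.2.1 x = true → a.1 j = true) fun n _ ι ν μ => ?_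
  simp [trackWord]

theorem var_mem_set (X : Fin m) (x : Fin k) :
    Recognizable (ℓ := ℓ) (k := k) (m := m) fun _ _ _ ν μ => ν x ∈ μ X := by
  refine of_forall (fun a => a.2.1 x = true → a.2.2 X = true) fun n _ ι ν μ => ?_
  simp [trackWord]

theorem zero_eq_var (x : Fin k) :
    Recognizable (ℓ := ℓ) (k := k) (m := m) fun _ _ _ ν _ => 0 = ν x := by
  refine of_local (fun a => a.2.1 x = true) (fun _ => True) (fun _ _ => True)
    fun n _ ι ν μ => ?_
  simp only [trackWord, decide_eq_true_eq, implies_true, and_true]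
  constructor
  · intro h i hi
    rw [← h, Fin.ext_iff, hi]
    rfl
  · exact fun h => (h 0 rfl).symm

/-- The condition on the last letter accounts for the loop of the successor at `n - 1`. -/
theorem next_eq_var (x y : Fin k) :
    Recognizable (ℓ := ℓ) (k := k) (m := m) fun _ _ _ ν _ => next (ν x) = ν y := by
  refine of_local (fun _ => True) (fun a => a.2.1 x = true → a.2.1 y = true)
    (fun a b => a.2.1 x = true → b.2.1 y = true) fun n _ ι ν μ => ?_
  simp only [trackWord, decide_eq_true_eq, implies_true, true_and]
  constructor
  · intro h
    constructor
    · rintro i j hij rfl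
      rw [← h, next, dif_pos (by omega), Fin.ext_iff]
      exact hij.symm
    · rintro i hi rfl
      rw [← h, next, dif_neg (by omega)]
  · rintro ⟨h1, h2⟩
    by_cases h : (ν x).val + 1 < n
    · rw [next, dif_pos h]
      exact (h1 (ν x) ⟨_, h⟩ rfl rfl).symm
    · rw [next, dif_neg h]
      exact (h2 (ν x) (by omega) rfl).symm

/-- Nested successors are unfolded by naming the value of each subterm with a fresh quantified
variable. The renaming `f` keeps the induction hypothesis usable under these extra variables. -/
theorem eval_eq_var (t : Term k) {K : ℕ} (f : Fin k → Fin K) (x : Fin K) :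
    Recognizable (ℓ := ℓ) (k := K) (m := m) fun _ _ _ ν _ =>
      t.eval (fun i => ν (f i)) = ν x := by
  induction t generalizing K with
  | zero => exact zero_eq_var x
  | var i => exact var_eq (f i) x
  | succ t ih =>
    have h := ((ih (fun i => (f i).succ) 0).and (next_eq_var (ℓ := ℓ) (m := m) 0 x.succ)).exists_fst
    simpa [Term.eval] using h

theorem exists_eval (t : Term k) {P : Property ℓ (k + 1) m} (h : Recognizable P) :
    Recognizable fun n _ ι ν μ =>
      P n ι (Fin.cons (α := fun _ => Fin n) (t.eval ν) ν) μ := by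
  simpa using ((eval_eq_var t Fin.succ 0).and h).exists_fst

theorem sat (φ : Formula ℓ k m) : Recognizable fun _ _ ι ν μ => φ.Sat ι ν μ := by
  induction φ with
  | eq t₁ t₂ => simpa [Formula.Sat, eq_comm] using exists_eval t₁ (eval_eq_var t₂ Fin.succ 0)
  | pr j t => simpa [Formula.Sat] using exists_eval t (var_mem_pred j 0)
  | mem X t => simpa [Formula.Sat] using exists_eval t (var_mem_set X 0)
  | and φ ψ hφ hψ => exact hφ.and hψ
  | neg φ h => exact h.not
  | ex φ h => exact h.exists_fst
  | exSet φ h => exact h.exists_set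

end Recognizable

theorem exists_isAutomatonFor {ℓ : ℕ} (φ : Sentence ℓ) :
    ∃ (q : ℕ) (A : NFA (Letter ℓ) (Fin q)), IsAutomatonFor A φ := by
  obtain ⟨L, ⟨σ, _, M, rfl⟩, h⟩ := Recognizable.sat φ
  -- A sentence has no variable tracks, so its track letters are just letters.
  have hM : (M.comap fun a : Letter ℓ => (a, Fin.elim0, Fin.elim0)).accepts.IsRegular :=
    ⟨σ, inferInstance, _, rfl⟩
  obtain ⟨q, A, hA⟩ := hM.exists_nfa
  refine ⟨q, A, fun S => ?_⟩
  refine (h _ _ _ _).trans ?_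
  rw [hA, DFA.accepts_comap]
  change _ ↔ List.map _ _ ∈ M.accepts
  rw [Structure.word, List.map_ofFn]
  have : trackWord S.ι Fin.elim0 Fin.elim0 = (fun a : Letter ℓ => (a, Fin.elim0, Fin.elim0)) ∘
      fun (i : Fin S.n) (j : Fin ℓ) => decide (i ∈ S.ι j) := by
    funext i
    exact Prod.ext rfl (Prod.ext (funext fun x => x.elim0) (funext fun x => x.elim0))
  rw [this]

end WS1S

/-! ### Semantics and polarity of the derived connectives. -/

namespace WS1S

namespace Formula

variable {ℓ k m : ℕ}

section Semantics

variable {n : ℕ} [NeZero n] (ι : Fin ℓ → Finset (Fin n)) (ν : Fin k → Fin n)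
  (μ : Fin m → Finset (Fin n))

theorem sat_or (φ ψ : Formula ℓ k m) :
    (or φ ψ).Sat ι ν μ ↔ φ.Sat ι ν μ ∨ ψ.Sat ι ν μ := by
  simp only [or, Sat]; tauto

theorem sat_imp (φ ψ : Formula ℓ k m) :
    (imp φ ψ).Sat ι ν μ ↔ (φ.Sat ι ν μ → ψ.Sat ι ν μ) := by
  simp only [imp, sat_or, Sat]; tauto

theorem sat_all (φ : Formula ℓ (k + 1) m) :
    (all φ).Sat ι ν μ ↔ ∀ a : Fin n, φ.Sat ι (Fin.cons (α := fun _ => Fin n) a ν) μ := by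
  simp only [all, Sat, not_exists, not_not]

theorem sat_allSet (φ : Formula ℓ k (m + 1)) :
    (allSet φ).Sat ι ν μ ↔
      ∀ B : Finset (Fin n), φ.Sat ι ν (Fin.cons (α := fun _ => Finset (Fin n)) B μ) := by
  simp only [allSet, Sat, not_exists, not_not]

theorem sat_bigOr {α : Type} (s : Finset α) (f : α → Formula ℓ k m) :
    (bigOr s f).Sat ι ν μ ↔ ∃ a ∈ s, (f a).Sat ι ν μ := by
  have h (l : List α) : ((l.map f).foldr or bot).Sat ι ν μ ↔ ∃ a ∈ l, (f a).Sat ι ν μ := by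
    induction l with
    | nil => simp [bot, top, Sat]
    | cons a l ih => simp [sat_or, ih]
  simpa [bigOr] using h s.toList

theorem sat_bigAnd {α : Type} (s : Finset α) (f : α → Formula ℓ k m) :
    (bigAnd s f).Sat ι ν μ ↔ ∀ a ∈ s, (f a).Sat ι ν μ := by
  have h (l : List α) : ((l.map f).foldr and top).Sat ι ν μ ↔ ∀ a ∈ l, (f a).Sat ι ν μ := by
    induction l with
    | nil => simp [top, Sat]
    | cons a l ih => simp [Sat, ih]
  simpa [bigAnd] using h s.toList

theorem sat_exSets (φ : Formula ℓ k m) (μ₀ : Fin 0 → Finset (Fin n)) :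
    (exSets φ).Sat ι ν μ₀ ↔ ∃ μ : Fin m → Finset (Fin n), φ.Sat ι ν μ := by
  induction m with
  | zero =>
    rw [exSets]
    exact ⟨fun h => ⟨μ₀, h⟩, fun ⟨μ, h⟩ => Subsingleton.elim μ μ₀ ▸ h⟩
  | succ m ih =>
    rw [exSets, ih]
    constructor
    · rintro ⟨μ, B, h⟩
      exact ⟨_, h⟩
    · rintro ⟨μ, h⟩
      refine ⟨Fin.tail μ, μ 0, ?_⟩
      rwa [Fin.cons_self_tail]

theorem _root_.WS1S.forall_next_closed_iff_le {n : ℕ} (a b : Fin n) :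
    (∀ B : Finset (Fin n), a ∈ B → (∀ i ∈ B, next i ∈ B) → b ∈ B) ↔ a ≤ b := by
  constructor
  · intro h
    -- The up-set of `a` is the smallest closed set containing `a`.
    have := h (Finset.univ.filter fun i => a ≤ i) (by simp) fun i hi => by
      simp only [Finset.mem_filter, Finset.mem_univ, true_and, next] at hi ⊢
      split
      · exact hi.trans (by simp [Fin.le_def])
      · exact hi
    simpa using this
  · intro hab B ha hB
    have key (c : ℕ) (hc : a.val + c < n) : (⟨a + c, hc⟩ : Fin n) ∈ B := by
      induction c with
      | zero => exact ha
      | succ c ih =>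
        have := hB _ (ih (by omega))
        rwa [next, dif_pos (by simpa [Nat.add_assoc] using hc)] at this
    rw [Fin.le_def] at hab
    have e : b = ⟨a + (b - a), by omega⟩ := Fin.ext (by simp only; omega)
    rw [e]
    exact key _ _

theorem sat_le (t₁ t₂ : Term k) :
    (le t₁ t₂ : Formula ℓ k m).Sat ι ν μ ↔ t₁.eval ν ≤ t₂.eval ν := by
  rw [← forall_next_closed_iff_le]
  simp only [le, sat_allSet, sat_imp, sat_all, Sat, Term.eval, Fin.cons_zero, and_imp]

end Semantics

section Parity

variable (b : Bool)

theorem occursWithParity_or {φ ψ : Formula ℓ k m} :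
    OccursWithParity b (or φ ψ) ↔ OccursWithParity b φ ∧ OccursWithParity b ψ := by
  simp [or, OccursWithParity]

theorem occursWithParity_all {φ : Formula ℓ (k + 1) m} :
    OccursWithParity b (all φ) ↔ OccursWithParity b φ := by
  simp [all, OccursWithParity]

theorem occursWithParity_le (t₁ t₂ : Term k) :
    OccursWithParity b (le t₁ t₂ : Formula ℓ k m) := by
  simp [le, allSet, imp, or, all, OccursWithParity]

theorem occursWithParity_bigOr {α : Type} (s : Finset α) {f : α → Formula ℓ k m}
    (h : ∀ a, OccursWithParity b (f a)) : OccursWithParity b (bigOr s f) := by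
  unfold bigOr
  induction s.toList with
  | nil => trivial
  | cons a l ih => exact (occursWithParity_or b).2 ⟨h a, ih⟩

theorem occursWithParity_bigAnd {α : Type} (s : Finset α) {f : α → Formula ℓ k m}
    (h : ∀ a, OccursWithParity b (f a)) : OccursWithParity b (bigAnd s f) := by
  unfold bigAnd
  induction s.toList with
  | nil => trivial
  | cons a l ih => exact ⟨h a, ih⟩

theorem occursWithParity_exSets {φ : Formula ℓ k m} (h : OccursWithParity b φ) :
    OccursWithParity b (exSets φ) := by
  induction m with
  | zero => exact h
  | succ m ih => exact ih h

end Parity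

end Formula

open Formula

theorem positive_ones {ℓ k m : ℕ} (σ : Letter ℓ) (t : Term k) :
    (ones σ t : Formula ℓ k m).Positive :=
  occursWithParity_bigAnd _ _ fun _ => rfl

/-- Apart from the double negations hidden in abbreviations, negation only reaches set atoms and
`le`, which contain no predicate symbol. -/
theorem positive_ppos {ℓ q : ℕ} (A : NFA (Letter ℓ) (Fin q)) : (ppos A).Positive := by
  refine occursWithParity_exSets _ ⟨?_, ?_, ?_, ?_⟩
  · refine (occursWithParity_all _).2 ⟨occursWithParity_bigOr _ _ fun _ => trivial,
      occursWithParity_bigAnd _ _ fun _ => (occursWithParity_or _).2 ⟨trivial, trivial⟩⟩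
  · exact occursWithParity_bigOr _ _ fun _ => trivial
  · refine (occursWithParity_all _).2 ((occursWithParity_all _).2 ((occursWithParity_or _).2
      ⟨occursWithParity_le _ _ _, occursWithParity_bigOr _ _ fun _ =>
        ⟨trivial, trivial, positive_ones _ _⟩⟩))
  · exact ⟨(occursWithParity_all _).2 (occursWithParity_le _ _ _),
      occursWithParity_bigOr _ _ fun _ => ⟨trivial, positive_ones _ _⟩⟩

/-! ### The positive sentence describes runs of the saturated automaton. -/

section PposSemantics

variable {ℓ q n : ℕ} [NeZero n] (A : NFA (Letter ℓ) (Fin q)) (ι : Fin ℓ → Finset (Fin n))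
  (ν : Fin 0 → Fin n) (μ : Fin q → Finset (Fin n))

theorem sat_ones {k m : ℕ} (σ : Letter ℓ) (t : Term k) (ν : Fin k → Fin n)
    (μ : Fin m → Finset (Fin n)) :
    (ones σ t : Formula ℓ k m).Sat ι ν μ ↔ σ ≤ fun j => decide (t.eval ν ∈ ι j) := by
  simp [ones, sat_bigAnd, Sat, Pi.le_def, Bool.le_iff_imp]

theorem sat_psiCover :
    (psiCover ℓ q).Sat ι ν μ ↔ ∃ r : Fin n → Fin q, ∀ i x, x ∈ μ i ↔ r x = i := by
  simp only [psiCover, sat_all, sat_bigOr, sat_bigAnd, sat_or, Sat, Term.eval, Fin.cons_zero,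
    Finset.mem_univ, Finset.mem_filter, true_and]
  constructor
  · intro h
    choose r hr using fun x => (h x).1
    refine ⟨r, fun i x => ⟨fun hi => ?_, fun hi => hi ▸ hr x⟩⟩
    rcases lt_trichotomy (r x) i with h' | h' | h'
    · have := (h x).2 (r x, i) h'
      exact (this.elim (· (hr x)) (· hi)).elim
    · exact h'
    · have := (h x).2 (i, r x) h'
      exact (this.elim (· hi) (· (hr x))).elim
  · rintro ⟨r, hr⟩ x
    refine ⟨⟨r x, (hr _ _).2 rfl⟩, fun p hp => ?_⟩
    rw [hr, hr, ← not_and_or]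
    rintro ⟨h1, h2⟩
    exact hp.ne (h1.symm.trans h2)

variable {μ} {r : Fin n → Fin q} (hr : ∀ i x, x ∈ μ i ↔ r x = i)

include hr

theorem sat_psiInit : (psiInit A).Sat ι ν μ ↔ r 0 ∈ A.start := by
  simp [psiInit, sat_bigOr, Sat, Term.eval, hr]

/-- The variable `y` only witnesses that `x` is not the last position, where the successor would
loop. -/
theorem sat_psiStep : (psiStep A).Sat ι ν μ ↔ ∀ x y : Fin n, y.val = x.val + 1 →
    r y ∈ (saturate A).step (r x) fun j => decide (x ∈ ι j) := by
  have e (x y : Fin n) : (Fin.cons (α := fun _ => Fin n) y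
    (Fin.cons (α := fun _ => Fin n) x ν) : Fin 2 → Fin n) 1 = x := rfl
  simp only [psiStep, sat_all, sat_or, sat_le, sat_bigOr, Sat, Term.eval, Fin.cons_zero, sat_ones,
    hr, transitions, Finset.mem_filter, Finset.mem_univ, true_and, saturate, e, Set.mem_ofPred_eq]
  constructor
  · intro h x y hxy
    obtain h | ⟨⟨s, σ, s'⟩, hs, rfl, hs', hσ⟩ := h x y
    · rw [Fin.le_def] at h; omega
    · have hy : next x = y := by
        rw [next, dif_pos (by omega), Fin.ext_iff]
        exact hxy.symm
      rw [hy] at hs'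
      exact ⟨σ, hσ, hs' ▸ hs⟩
  · intro h x y
    refine or_iff_not_imp_left.2 fun hxy => ?_
    rw [not_le, Fin.lt_def] at hxy
    have hx : x.val + 1 < n := by omega
    obtain ⟨σ, hσ, hs⟩ := h x ⟨x + 1, hx⟩ rfl
    refine ⟨(r x, σ, _), hs, rfl, ?_, hσ⟩
    rw [next, dif_pos hx]

theorem sat_psiFinal : (psiFinal A).Sat ι ν μ ↔ ∃ x : Fin n, x.val + 1 = n ∧
    ∃ s ∈ A.accept, s ∈ (saturate A).step (r x) fun j => decide (x ∈ ι j) := by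
  have e (x y : Fin n) : (Fin.cons (α := fun _ => Fin n) y
    (Fin.cons (α := fun _ => Fin n) x ν) : Fin 2 → Fin n) 1 = x := rfl
  simp only [psiFinal, sat_all, sat_le, sat_bigOr, Sat, Term.eval, Fin.cons_zero, sat_ones,
    hr, transitions, Finset.mem_filter, Finset.mem_univ, true_and, saturate, e, Set.mem_ofPred_eq]
  refine exists_congr fun x => and_congr ?_ ?_
  · have hn := NeZero.pos n
    refine ⟨fun h => ?_, fun h y => ?_⟩
    · have := h ⟨n - 1, by omega⟩
      rw [Fin.le_def] at this
      simp only at this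
      omega
    · rw [Fin.le_def]
      omega
  · constructor
    · rintro ⟨⟨s, σ, s'⟩, ⟨hs, ha⟩, rfl, hσ⟩
      exact ⟨s', ha, σ, hσ, hs⟩
    · rintro ⟨s', ha, σ, hσ, hs⟩
      exact ⟨(r x, σ, s'), ⟨hs, ha⟩, rfl, hσ⟩

end PposSemantics

theorem models_ppos_iff {ℓ q : ℕ} (A : NFA (Letter ℓ) (Fin q)) (S : Structure ℓ) :
    S.Models (ppos A) ↔ S.word ∈ (saturate A).accepts := by
  rw [Structure.word, NFA.ofFn_mem_accepts_iff, Structure.Models, ppos, sat_exSets]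
  simp only [Sat, sat_psiCover]
  have hpos := NeZero.pos S.n
  constructor
  · rintro ⟨μ, ⟨r, hr⟩, h0, hs, hf⟩
    rw [sat_psiInit _ _ _ hr] at h0
    rw [sat_psiStep _ _ _ hr] at hs
    rw [sat_psiFinal _ _ _ hr] at hf
    obtain ⟨x, hx, s, ha, hf⟩ := hf
    -- The sets label only `n` positions, while a run has `n + 1` states; the last one is the target
    -- `s` supplied by `psiFinal`.
    refine ⟨fun i => if h : i < S.n then r ⟨i, h⟩ else s, ?_, by simpa using show s ∈ (saturate A).accept from ha,
      fun i => ?_⟩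
    · simp only [hpos, dif_pos]
      exact h0
    · simp only [i.isLt, dif_pos]
      split
      · rename_i h
        exact hs i ⟨i + 1, h⟩ rfl
      · have : i = x := Fin.ext (by omega)
        exact this ▸ hf
  · rintro ⟨r, h0, hn, hs⟩
    have hr (i : Fin q) (x : Fin S.n) :
        x ∈ Finset.univ.filter (fun y : Fin S.n => r y = i) ↔ r x = i := by simp
    refine ⟨fun i => Finset.univ.filter fun x : Fin S.n => r x = i, ⟨fun x => r x, hr⟩, ?_, ?_, ?_⟩
    · exact (sat_psiInit _ _ _ hr).2 h0
    · refine (sat_psiStep _ _ _ hr).2 fun x y hxy => ?_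
      rw [hxy]
      exact hs x
    · refine (sat_psiFinal _ _ _ hr).2 ⟨⟨S.n - 1, by omega⟩, ?_, r S.n, hn, ?_⟩
      · simp only; omega
      · have := hs ⟨S.n - 1, by omega⟩
        simp only [Nat.sub_add_cancel hpos] at this
        exact this

/-! ### Upward closure and minimal models. -/

theorem word_mem_saturate_iff {ℓ q : ℕ} (A : NFA (Letter ℓ) (Fin q)) (S : Structure ℓ) :
    S.word ∈ (saturate A).accepts ↔ ∃ S' : Structure ℓ, S'.Sub S ∧ S'.word ∈ A.accepts := by
  constructor
  · intro h
    rw [Structure.word, NFA.ofFn_mem_accepts_iff] at h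
    obtain ⟨r, h0, hn, hs⟩ := h
    choose f hf hs using hs
    -- The smaller structure is read off from the letters `f i` of the original transitions
    -- underlying the saturated run.
    refine ⟨⟨S.n, fun j => Finset.univ.filter fun i => f i j = true⟩, ⟨rfl, fun j i hi => ?_⟩, ?_⟩
    · exact of_decide_eq_true (Bool.le_iff_imp.1 (hf i j) (Finset.mem_filter.1 hi).2)
    · rw [Structure.word, NFA.ofFn_mem_accepts_iff]
      refine ⟨r, h0, hn, fun i => ?_⟩
      simpa using hs i
  · obtain ⟨m, ι⟩ := S
    rintro ⟨⟨n, ι'⟩, ⟨e, h⟩, hw⟩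
    change n = m at e
    subst e
    rw [Structure.word, NFA.ofFn_mem_accepts_iff] at hw ⊢
    obtain ⟨r, h0, hn, hs⟩ := hw
    refine ⟨r, h0, hn, fun i => ⟨_, fun j => ?_, hs i⟩⟩
    rw [Bool.le_iff_imp]
    simpa using h j i

theorem Structure.Sub.trans {ℓ : ℕ} {S₁ S₂ S₃ : Structure ℓ} (h : S₁.Sub S₂) (h' : S₂.Sub S₃) :
    S₁.Sub S₃ :=
  ⟨h.1.trans h'.1, fun j i hi => h'.2 j _ (h.2 j i hi)⟩

theorem Structure.Sub.refl {ℓ : ℕ} (S : Structure ℓ) : S.Sub S :=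
  ⟨rfl, fun _ _ h => h⟩

theorem Structure.Sub.antisymm {ℓ : ℕ} {S₁ S₂ : Structure ℓ} (h : S₁.Sub S₂) (h' : S₂.Sub S₁) :
    S₁ = S₂ := by
  obtain ⟨n, ι⟩ := S₁
  obtain ⟨n', ι'⟩ := S₂
  obtain ⟨e, h⟩ := h
  change n = n' at e
  subst e
  have : ι = ι' := funext fun j => Finset.ext fun i => ⟨h j i, h'.2 j i⟩
  subst this
  rfl

/-- A sentence and its closure under `⊑`-larger structures have the same minimal models. -/
theorem minEquiv_of_models_iff {ℓ : ℕ} {φ ψ : Sentence ℓ}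
    (h : ∀ S : Structure ℓ, S.Models ψ ↔ ∃ S' : Structure ℓ, S'.Sub S ∧ S'.Models φ) :
    MinEquiv φ ψ := by
  ext S
  constructor
  · rintro ⟨hS, hmin⟩
    refine ⟨(h S).2 ⟨S, .refl S, hS⟩, fun S' hS' hne hm => ?_⟩
    obtain ⟨T, hT, hTm⟩ := (h S').1 hm
    refine hmin T (hT.trans hS') ?_ hTm
    rintro rfl
    exact hne (hS'.antisymm hT)
  · rintro ⟨hS, hmin⟩
    have hφψ (T : Structure ℓ) (hT : T.Models φ) : T.Models ψ := (h T).2 ⟨T, .refl T, hT⟩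
    obtain ⟨T, hT, hTm⟩ := (h S).1 hS
    have e : T = S := by_contra fun hne => hmin T hT hne (hφψ T hTm)
    exact ⟨e ▸ hTm, fun S' hS' hne hm => hmin S' hS' hne (hφψ S' hm)⟩

end WS1S

theorem mainTheorem3 (ℓ : ℕ) (φ : WS1S.Sentence ℓ) :
    (∃ (q : ℕ) (A : NFA (WS1S.Letter ℓ) (Fin q)), WS1S.IsAutomatonFor A φ) ∧
    ∀ (q : ℕ) (A : NFA (WS1S.Letter ℓ) (Fin q)), WS1S.IsAutomatonFor A φ →
      (WS1S.ppos A).Positive ∧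
      (∀ S : WS1S.Structure ℓ,
        S.Models (WS1S.ppos A) ↔ S.word ∈ (WS1S.saturate A).accepts) ∧
      WS1S.MinEquiv φ (WS1S.ppos A) := by
  refine ⟨WS1S.exists_isAutomatonFor φ, fun q A hA =>
    ⟨WS1S.positive_ppos A, WS1S.models_ppos_iff A, WS1S.minEquiv_of_models_iff fun S => ?_⟩⟩
  rw [WS1S.models_ppos_iff, WS1S.word_mem_saturate_iff]
  exact exists_congr fun S' => and_congr_right fun _ => (hA S').symm
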